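/- A system $(X,T)$ is a compact metric space $X$ with a homeomorphism $T:X\to X$. It is minimal if $\{T^nx:n\in\mathbb Z\}$ is dense in $X$ for every $x\in X$, and equicontinuous if for every $\varepsilon>0$ there is $\delta>0$ such that $\rho(x,y)<\delta$ implies $\rho(T^nx,T^ny)<\varepsilon$ for all $n\in\mathbb Z$. A factor map $(X,T)\to(Z,R)$ is a continuous surjection $\pi:X\to Z$ with $\pi T=R\pi$. The maximal equicontinuous factor of a minimal system $(X,T)$ is the (unique up to isomorphism) equicontinuous system $X_{eq}$ with a factor map $\pi_X:X\to X_{eq}$ through which every factor map from $X$ to an equicontinuous system factors by a factor map. A joining of $(X,T)$ and $(Y,S)$ is a closed set $J\subset X\times Y$ with $(T\times S)J=J$ that projects onto $X$ and onto $Y$. Let $(X,T)$ and $(Y,S)$ be minimal systems. We write $X\perp_Q Y$ (quasi-disjoint) if $X\times Y$ is the only joining $J$ of $X$ and $Y$ with $(\pi_X\times\pi_Y)(J)=X_{eq}\times Y_{eq}$. The maximal common equicontinuous factor $Eq(X,Y)$ is the (unique up to isomorphism) equicontinuous system with factor maps $\alpha:X\to Eq(X,Y)$ and $\beta:Y\to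 Eq(X,Y)$ such that, for any equicontinuous system $W$ and factor maps $\phi:X\to W$, $\psi:Y\to W$, there are factor maps $\eta_1,\eta_2:Eq(X,Y)\to W$ with $\phi=\eta_1\alpha$ and $\psi=\eta_2\beta$. It is realized as a rotation $z\mapsto z+\theta$ of a compact metrizable abelian group, and $\gamma:X\times Y\to Eq(X,Y)$ is defined by $\gamma(x,y)=\alpha(x)-\beta(y)$. We write $X\perp_{SQ}Y$ (strongly quasi-disjoint) if there is a residual set $\Omega\subset Eq(X,Y)$ such that for every $z\in\Omega$ the fibre $\gamma^{-1}(z)$ is a minimal subset of $(X\times Y,T\times S)$, that is, nonempty, closed, $T\times S$-invariant and equal to the orbit closure of each of its points. (Neither notion depends on the choices made.) **Theorem.** Let $(X,T)$ and $(Y,S)$ be minimal systems and let $\pi:(X,T)\to(Z,R)$ be a factor map. Then 1. if $X\perp_Q Y$, then $Z\perp_Q Y$; 2. if $X\perp_{SQ} Y$, then $Z\perp_{SQ} Y$. -/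

import Mathlib

universe u

/-- A topological dynamical system is a compact metric space `X` with a homeomorphism
`T : X ≃ₜ X`. It is minimal if the (two-sided) orbit of every point is dense. -/
def IsMinimalSystem {X : Type u} [MetricSpace X] (T : X ≃ₜ X) : Prop :=
  ∀ x : X, Dense (Set.range fun n : ℤ => (T ^ n) x)

/-- `π` is a factor map (homomorphism) from the system `(X, T)` to the system `(Z, R)`. -/
structure IsFactorMap {X Z : Type u} [MetricSpace X] [MetricSpace Z]
    (T : X ≃ₜ X) (R : Z ≃ₜ Z) (π : X → Z) : Prop where
  continuous : Continuous π
  surjective : Function.Surjective π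
  semiconj : ∀ x : X, π (T x) = R (π x)

/-- `(X, T)` is equicontinuous: for every `ε > 0` there is `δ > 0` such that `dist x y < δ` implies
`dist (T ^ n x) (T ^ n y) < ε` for all `n : ℤ`. -/
def IsEquicontinuousSystem {X : Type u} [MetricSpace X] (T : X ≃ₜ X) : Prop :=
  UniformEquicontinuous fun (n : ℤ) (x : X) => (T ^ n) x

/-- The homeomorphism `(x, y) ↦ (T x, S y)` of `X × Y`. -/
def prodSystem {X Y : Type u} [MetricSpace X] [MetricSpace Y]
    (T : X ≃ₜ X) (S : Y ≃ₜ Y) : (X × Y) ≃ₜ (X × Y) :=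
  T.prodCongr S

/-- `M` is a minimal subset of `(X, T)`: nonempty, closed, invariant, and the orbit of each of its
points is dense in it. -/
structure IsMinimalSubset {X : Type u} [MetricSpace X] (T : X ≃ₜ X) (M : Set X) : Prop where
  nonempty : M.Nonempty
  isClosed : IsClosed M
  invariant : T '' M = M
  dense_orbit : ∀ x ∈ M, M ⊆ closure (Set.range fun n : ℤ => (T ^ n) x)

/-- A joining of `(X, T)` and `(Y, S)`: a closed `T × S`-invariant subset of `X × Y` which projects
onto each coordinate. -/
structure IsJoining {X Y : Type u} [MetricSpace X] [MetricSpace Y]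
    (T : X ≃ₜ X) (S : Y ≃ₜ Y) (J : Set (X × Y)) : Prop where
  isClosed : IsClosed J
  invariant : prodSystem T S '' J = J
  fst_image : Prod.fst '' J = Set.univ
  snd_image : Prod.snd '' J = Set.univ

/-- `(E, R)`, with the factor map `π : X → E`, is the maximal equicontinuous factor of `(X, T)`:
it is equicontinuous, and every factor map from `X` to an equicontinuous system factors through `π`.
This determines `(E, R, π)` up to a unique isomorphism. -/
structure IsMaxEquicontinuousFactor {X E : Type u} [MetricSpace X] [MetricSpace E]
    (T : X ≃ₜ X) (R : E ≃ₜ E) (π : X → E) : Prop where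
  factor : IsFactorMap T R π
  equicontinuous : IsEquicontinuousSystem R
  universal : ∀ (W : Type u) [MetricSpace W] [CompactSpace W] (Q : W ≃ₜ W) (φ : X → W),
    IsEquicontinuousSystem Q → IsFactorMap T Q φ →
      ∃ η : E → W, IsFactorMap R Q η ∧ φ = η ∘ π

/-- `(E, R)`, with the factor maps `α : X → E` and `β : Y → E`, is a maximal common equicontinuous
factor of `(X, T)` and `(Y, S)`. -/
structure IsMaxCommonEquicontinuousFactor {X Y E : Type u}
    [MetricSpace X] [MetricSpace Y] [MetricSpace E]
    (T : X ≃ₜ X) (S : Y ≃ₜ Y) (R : E ≃ₜ E) (α : X → E) (β : Y → E) : Prop where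
  factor_left : IsFactorMap T R α
  factor_right : IsFactorMap S R β
  equicontinuous : IsEquicontinuousSystem R
  universal : ∀ (W : Type u) [MetricSpace W] [CompactSpace W] (Q : W ≃ₜ W) (φ : X → W) (ψ : Y → W),
    IsEquicontinuousSystem Q → IsFactorMap T Q φ → IsFactorMap S Q ψ →
      ∃ η₁ η₂ : E → W, IsFactorMap R Q η₁ ∧ IsFactorMap R Q η₂ ∧ φ = η₁ ∘ α ∧ ψ = η₂ ∘ β

/-- `X ⊥_Q Y`: the product `X × Y` is the only joining of `X` and `Y` that projects onto
`X_eq × Y_eq`, where `πX : X → X_eq` and `πY : Y → Y_eq` are the maximal equicontinuous factors.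
As these are unique up to isomorphism, it does not matter which model of them is used. -/
def QuasiDisjoint {X Y : Type u} [MetricSpace X] [MetricSpace Y]
    (T : X ≃ₜ X) (S : Y ≃ₜ Y) : Prop :=
  ∃ (Xeq : Type u) (_ : MetricSpace Xeq) (_ : CompactSpace Xeq) (TX : Xeq ≃ₜ Xeq) (πX : X → Xeq)
    (Yeq : Type u) (_ : MetricSpace Yeq) (_ : CompactSpace Yeq) (SY : Yeq ≃ₜ Yeq) (πY : Y → Yeq),
    IsMaxEquicontinuousFactor T TX πX ∧ IsMaxEquicontinuousFactor S SY πY ∧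
      ∀ J : Set (X × Y), IsJoining T S J → Prod.map πX πY '' J = Set.univ → J = Set.univ

/-- `X ⊥_SQ Y`: realize the maximal common equicontinuous factor `Eq(X, Y)` as a rotation
`z ↦ z + θ` of a compact metrizable abelian group `E`, with factor maps `α : X → E` and `β : Y → E`,
and put `γ (x, y) = α x - β y`; then there is a residual set of `z : E` for which the fibre
`γ⁻¹(z)` is a minimal subset of `(X × Y, T × S)`. Any two such realizations differ by an isomorphism
of topological groups and translations, so it does not matter which one is used. -/
def StronglyQuasiDisjoint {X Y : Type u} [MetricSpace X] [MetricSpace Y]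
    (T : X ≃ₜ X) (S : Y ≃ₜ Y) : Prop :=
  ∃ (E : Type u) (_ : MetricSpace E) (_ : CompactSpace E) (_ : AddCommGroup E)
    (_ : IsTopologicalAddGroup E) (θ : E) (α : X → E) (β : Y → E),
    IsMaxCommonEquicontinuousFactor T S (Homeomorph.addRight θ) α β ∧
      ∃ Ω ∈ residual E, ∀ z ∈ Ω,
        IsMinimalSubset (prodSystem T S) ((fun p : X × Y => α p.1 - β p.2) ⁻¹' {z})

/-! Let `α : X → E` be the rotation attached to `X` (`X_eq` in part 1, `Eq(X, Y)` in part 2). Divide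
`E` by the closed subgroup `H` generated by the differences `α x - α x'` with `π x = π x'`. Then `α`
descends to `κ : Z → E/H`, and `E/H` inherits the universal property for `Z`. The crux, in
`exists_rotation_pushout`, is that `X` maps onto the fibre product of `Z` and `E` over `E/H`: any
compatible pair `(z, e)` comes from a single point of `X`. For part 1, this lifting shows that a
joining of `Z` and `Y` onto the equicontinuous factors pulls back to one of `X` and `Y` with the
same property. For part 2, it shows that the fibre over `q c` for `Z` is the image of the fibre over
`c` for `X`, hence minimal if the latter is; residual sets pass to `E/H` because `q` is open. -/

open Topology Set

/-! ### Orbits, minimality and joinings under factor maps -/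

section Basic

variable {X Y Z : Type u} [MetricSpace X] [MetricSpace Y] [MetricSpace Z]
  {T : X ≃ₜ X} {S : Y ≃ₜ Y} {R : Z ≃ₜ Z} {π : X → Z}

theorem Homeomorph.zpow_add_apply (T : X ≃ₜ X) (m n : ℤ) (x : X) :
    (T ^ (m + n)) x = (T ^ m) ((T ^ n) x) := by
  rw [zpow_add]; rfl

theorem IsFactorMap.map_zpow (hπ : IsFactorMap T R π) (n : ℤ) (x : X) :
    π ((T ^ n) x) = (R ^ n) (π x) := by
  have key : ∀ (k : ℕ) (x : X), π ((T ^ k) x) = (R ^ k) (π x) := by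
    intro k
    induction k with
    | zero => intro x; rfl
    | succ k ih =>
      intro x
      rw [pow_succ, pow_succ]
      change π ((T ^ k) (T x)) = (R ^ k) (R (π x))
      rw [ih, hπ.semiconj]
  obtain ⟨k, rfl | rfl⟩ := n.eq_nat_or_neg
  · simpa using key k x
  · rw [zpow_neg, zpow_neg, zpow_natCast, zpow_natCast]
    have h := key k ((T ^ k)⁻¹ x)
    have h1 : (T ^ k) ((T ^ k)⁻¹ x) = x := (T ^ k).apply_symm_apply x
    rw [h1] at h
    rw [h]
    exact ((R ^ k).symm_apply_apply _).symm

theorem IsFactorMap.comp {φ : Z → Y} (hφ : IsFactorMap R S φ) (hπ : IsFactorMap T R π) :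
    IsFactorMap T S (φ ∘ π) where
  continuous := hφ.continuous.comp hπ.continuous
  surjective := hφ.surjective.comp hπ.surjective
  semiconj x := by simp only [Function.comp_apply, hπ.semiconj, hφ.semiconj]

theorem IsMinimalSystem.map (hT : IsMinimalSystem T) (hπ : IsFactorMap T R π) :
    IsMinimalSystem R := by
  intro z
  obtain ⟨x, rfl⟩ := hπ.surjective z
  have h : DenseRange (π ∘ fun n : ℤ => (T ^ n) x) :=
    hπ.surjective.denseRange.comp (hT x) hπ.continuous
  have e : (π ∘ fun n : ℤ => (T ^ n) x) = fun n : ℤ => (R ^ n) (π x) :=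
    funext fun n => hπ.map_zpow n x
  rwa [e] at h

/-- The form in which minimality is used below: a closed condition need only be checked along one
orbit. -/
theorem IsMinimalSystem.forall_mem_of_isClosed (hT : IsMinimalSystem T) {C : Set X}
    (hC : IsClosed C) {x₀ : X} (h₀ : ∀ n : ℤ, (T ^ n) x₀ ∈ C) (x : X) : x ∈ C :=
  closure_minimal (range_subset_iff.2 h₀) hC (hT x₀ x)

theorem IsFactorMap.prodMap_id (hπ : IsFactorMap T R π) (S : Y ≃ₜ Y) :
    IsFactorMap (prodSystem T S) (prodSystem R S) (Prod.map π id) where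
  continuous := hπ.continuous.prodMap continuous_id
  surjective := hπ.surjective.prodMap Function.surjective_id
  semiconj p := Prod.ext (hπ.semiconj p.1) rfl

theorem IsMinimalSubset.image [CompactSpace X] {M : Set X} (hM : IsMinimalSubset T M)
    (hπ : IsFactorMap T R π) : IsMinimalSubset R (π '' M) where
  nonempty := hM.nonempty.image π
  isClosed := (hM.isClosed.isCompact.image hπ.continuous).isClosed
  invariant := by
    conv_rhs => rw [← hM.invariant]
    rw [image_image, image_image]
    exact image_congr fun x _ => (hπ.semiconj x).symm
  dense_orbit := by
    rintro _ ⟨x, hx, rfl⟩ _ ⟨x', hx', rfl⟩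
    have h := image_closure_subset_closure_image hπ.continuous
      (mem_image_of_mem π (hM.dense_orbit x hx hx'))
    rw [← range_comp] at h
    have e : (π ∘ fun n : ℤ => (T ^ n) x) = fun n : ℤ => (R ^ n) (π x) :=
      funext fun n => hπ.map_zpow n x
    rwa [e] at h

theorem IsJoining.preimage {J : Set (Z × Y)} (hJ : IsJoining R S J) (hπ : IsFactorMap T R π) :
    IsJoining T S (Prod.map π id ⁻¹' J) where
  isClosed := hJ.isClosed.preimage (hπ.prodMap_id S).continuous
  invariant := by
    have hinv : ∀ p, prodSystem R S p ∈ J ↔ p ∈ J := fun p => by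
      conv_lhs => rw [← hJ.invariant]
      exact (prodSystem R S).injective.mem_set_image
    ext p
    obtain ⟨p, rfl⟩ := (prodSystem T S).surjective p
    rw [(prodSystem T S).injective.mem_set_image, mem_preimage, mem_preimage,
      (hπ.prodMap_id S).semiconj, hinv]
  fst_image := eq_univ_of_forall fun x => by
    obtain ⟨p, hp, h⟩ : π x ∈ Prod.fst '' J := hJ.fst_image ▸ mem_univ _
    exact ⟨(x, p.2), by simpa [← h] using hp, rfl⟩
  snd_image := eq_univ_of_forall fun y => by
    obtain ⟨p, hp, h⟩ : y ∈ Prod.snd '' J := hJ.snd_image ▸ mem_univ _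
    obtain ⟨x, hx⟩ := hπ.surjective p.1
    exact ⟨(x, y), by simpa [hx, ← h] using hp, rfl⟩

end Basic

/-- A continuous open surjection from a compact metrizable space maps residual sets to residual
sets. -/
theorem image_mem_residual_of_isOpenMap {E F : Type*} [TopologicalSpace E] [CompactSpace E]
    [T2Space E] [SecondCountableTopology E] [TopologicalSpace F] [T1Space F] {q : E → F}
    (hc : Continuous q) (ho : IsOpenMap q) (hs : Function.Surjective q) {Ω : Set E}
    (hΩ : Ω ∈ residual E) : q '' Ω ∈ residual F := by
  obtain ⟨U, hUo, hUd, hUc, hUΩ⟩ := mem_residual_iff.1 hΩ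
  let B := TopologicalSpace.countableBasis E
  have hB : TopologicalSpace.IsTopologicalBasis B := TopologicalSpace.isBasis_countableBasis E
  have hBc : B.Countable := TopologicalSpace.countable_countableBasis E
  -- This is the set of `w` such that the fibre over `w` meets `u ∩ V` as soon as it meets `V`.
  have key : ∀ u ∈ U, ∀ V ∈ B, q '' (u ∩ V) ∪ (q '' V)ᶜ ∈ residual F := by
    intro u hu V hV
    have hVo : IsOpen V := hB.isOpen hV
    refine Filter.mem_of_superset (residual_of_dense_open
      ((ho _ ((hUo u hu).inter hVo)).union isClosed_closure.isOpen_compl :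
        IsOpen (q '' (u ∩ V) ∪ (closure (q '' V))ᶜ)) ?_)
      (union_subset_union_right _ (compl_subset_compl.2 subset_closure))
    rw [dense_iff_inter_open]
    intro W hW hWn
    by_cases h : (W ∩ q '' V).Nonempty
    · obtain ⟨_, hw, v, hv, rfl⟩ := h
      obtain ⟨e, ⟨heV, heW⟩, heu⟩ := (hUd u hu).inter_open_nonempty (V ∩ q ⁻¹' W)
        (hVo.inter (hW.preimage hc)) ⟨v, hv, hw⟩
      exact ⟨q e, heW, Or.inl ⟨e, ⟨heu, heV⟩, rfl⟩⟩
    · obtain ⟨w, hw⟩ := hWn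
      refine ⟨w, hw, Or.inr fun hcl => h ?_⟩
      exact mem_closure_iff.1 hcl W hW hw
  have hmem : (⋂ u ∈ U, ⋂ V ∈ B, (q '' (u ∩ V) ∪ (q '' V)ᶜ)) ∈ residual F :=
    (countable_bInter_mem hUc).2 fun u hu => (countable_bInter_mem hBc).2 fun V hV => key u hu V hV
  refine Filter.mem_of_superset hmem fun w hw => ?_
  simp only [mem_iInter] at hw
  have hK : IsClosed (q ⁻¹' {w}) := isClosed_singleton.preimage hc
  have : CompactSpace (q ⁻¹' {w}) := isCompact_iff_compactSpace.1 hK.isCompact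
  obtain ⟨e₀, he₀⟩ := hs w
  have : Nonempty (q ⁻¹' {w}) := ⟨⟨e₀, he₀⟩⟩
  -- For such `w` every `u` is dense in the fibre, so Baire's theorem in the compact fibre gives a
  -- point of `Ω` over `w`.
  have hd : Dense (⋂ u ∈ U, ((↑) ⁻¹' u : Set (q ⁻¹' {w}))) := by
    refine dense_biInter_of_isOpen (fun u hu => (hUo u hu).preimage continuous_subtype_val) hUc
      fun u hu => ?_
    rw [dense_iff_inter_open]
    rintro _ ⟨O, hO, rfl⟩ ⟨⟨e, he⟩, heO⟩
    obtain ⟨V, hV, heV, hVO⟩ := hB.exists_subset_of_mem_open heO hO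
    rcases hw u hu V hV with ⟨e', ⟨hu', hV'⟩, he'⟩ | h
    · exact ⟨⟨e', he'⟩, hVO hV', hu'⟩
    · exact absurd ⟨e, heV, he⟩ h
  obtain ⟨e, he⟩ := hd.nonempty
  simp only [mem_iInter] at he
  exact ⟨e, hUΩ (mem_sInter.2 he), e.2⟩

/-! ### Minimal equicontinuous systems are group rotations -/

section GroupCompletion

/-- A group structure on `A` extends to a complete space `E` along a dense map `f : A → E` for which
subtraction is uniformly continuous. -/
theorem exists_addCommGroup_of_denseRange {A : Type*} [AddCommGroup A] {E : Type u} [MetricSpace E]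
    [CompleteSpace E] {f : A → E} (hf : DenseRange f)
    (hsub : ∀ ε > 0, ∃ δ > 0, ∀ a a' b b' : A, dist (f a) (f a') < δ → dist (f b) (f b') < δ →
      dist (f (a - b)) (f (a' - b')) < ε) :
    ∃ _ : AddCommGroup E, IsTopologicalAddGroup E ∧ ∀ a b, f (a + b) = f a + f b := by
  let uA : UniformSpace A := UniformSpace.comap f inferInstance
  have hui : IsUniformInducing f := ⟨rfl⟩
  have : IsUniformAddGroup A := by
    refine ⟨hui.uniformContinuous_iff.2 ?_⟩
    have hbasis := (Metric.uniformity_basis_dist (α := E)).comap (Prod.map f f)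
    have hA : (uniformity A).HasBasis (fun ε : ℝ => 0 < ε)
        fun ε => Prod.map f f ⁻¹' {p : E × E | dist p.1 p.2 < ε} := hbasis
    refine (hA.uniformity_prod hA |>.tendsto_iff Metric.uniformity_basis_dist).2 ?_
    intro ε hε
    obtain ⟨δ, hδ, h⟩ := hsub ε hε
    refine ⟨(δ, δ), ⟨hδ, hδ⟩, ?_⟩
    rintro ⟨⟨a, b⟩, ⟨a', b'⟩⟩ hab
    exact h a a' b b' hab.1 hab.2
  let pkg : AbstractCompletion A :=
    { space := E
      coe := f
      uniformStruct := inferInstance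
      complete := inferInstance
      separation := inferInstance
      isUniformInducing := hui
      dense := hf }
  -- `E` is a completion of `A` for the uniformity pulled back along `f`, so the group structure is
  -- transported from `Completion A`.
  let e : E ≃ᵤ UniformSpace.Completion A := pkg.compareEquiv UniformSpace.Completion.cPkg
  have he : ∀ a, e (f a) = (a : UniformSpace.Completion A) := fun a =>
    pkg.compare_coe UniformSpace.Completion.cPkg a
  let gE : AddCommGroup E := e.toEquiv.addCommGroup
  have hadd : ∀ x y : E, e (x + y) = e x + e y := fun x y => e.toEquiv.apply_symm_apply _
  have hneg : ∀ x : E, e (-x) = -e x := fun x => e.toEquiv.apply_symm_apply _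
  refine ⟨gE, { continuous_add := ?_, continuous_neg := ?_ }, fun a b => ?_⟩
  · refine e.toHomeomorph.isInducing.continuous_iff.2 ?_
    have h : Continuous fun p : E × E => e p.1 + e p.2 :=
      (e.continuous.comp continuous_fst).add (e.continuous.comp continuous_snd)
    exact h.congr fun p => (hadd p.1 p.2).symm
  · refine e.toHomeomorph.isInducing.continuous_iff.2 ?_
    exact e.continuous.neg.congr fun x => (hneg x).symm
  · apply e.injective
    rw [hadd, he, he, he, UniformSpace.Completion.coe_add]

/-- A minimal equicontinuous system on a nonempty compact space is a rotation of a topological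
group. -/
theorem IsEquicontinuousSystem.exists_eq_addRight {E : Type u} [MetricSpace E] [CompactSpace E]
    [Nonempty E] {R : E ≃ₜ E} (hR : IsEquicontinuousSystem R) (hmin : IsMinimalSystem R) :
    ∃ (_ : AddCommGroup E) (_ : IsTopologicalAddGroup E) (θ : E), R = Homeomorph.addRight θ := by
  obtain ⟨e₀⟩ := ‹Nonempty E›
  have hf : DenseRange fun n : ℤ => (R ^ n) e₀ := hmin e₀
  obtain ⟨gE, htop, hadd⟩ := exists_addCommGroup_of_denseRange hf (by
    intro ε hε
    obtain ⟨δ, hδ, h⟩ := Metric.uniformEquicontinuous_iff.1 hR (ε / 2) (half_pos hε)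
    refine ⟨δ, hδ, fun a a' b b' ha hb => ?_⟩
    -- Both `a - b` and `a' - b'` are compared with `a' - b`; these powers of `R` move the given
    -- pairs of orbit points there.
    have h₁ := h _ _ ha (-b)
    have h₂ := h _ _ hb (a' - b - b')
    simp only [← Homeomorph.zpow_add_apply] at h₁ h₂
    rw [show -b + a = a - b by ring, show -b + a' = a' - b by ring] at h₁
    rw [show a' - b - b' + b = a' - b' by ring, show a' - b - b' + b' = a' - b by ring,
      dist_comm] at h₂
    linarith [dist_triangle ((R ^ (a - b)) e₀) ((R ^ (a' - b)) e₀) ((R ^ (a' - b')) e₀)])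
  refine ⟨gE, htop, R e₀, Homeomorph.ext fun x => ?_⟩
  have h : (R : E → E) = fun x => x + R e₀ := by
    refine hf.equalizer R.continuous (continuous_id.add continuous_const) (funext fun n => ?_)
    have h' := hadd n 1
    simp only [zpow_one] at h'
    change R ((R ^ n) e₀) = (R ^ n) e₀ + R e₀
    rw [← h', add_comm, Homeomorph.zpow_add_apply, zpow_one]
  exact congrFun h x

end GroupCompletion

/-! ### Rotations and the pushout of `Z` and `G` under `X` -/

section Rotation

theorem isEquicontinuousSystem_addRight {G : Type u} [MetricSpace G] [CompactSpace G]
    [AddCommGroup G] [IsTopologicalAddGroup G] (θ : G) :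
    IsEquicontinuousSystem (Homeomorph.addRight θ) := by
  have : IsUniformAddGroup G := IsUniformAddGroup.of_compactSpace
  refine Metric.uniformEquicontinuous_iff.2 fun ε hε => ?_
  obtain ⟨δ, hδ, h⟩ := Metric.uniformContinuous_iff.1 (uniformContinuous_add (α := G)) ε hε
  refine ⟨δ, hδ, fun x y hxy n => ?_⟩
  have hn : ∀ x : G, (Homeomorph.addRight θ ^ n) x = x + (Homeomorph.addRight θ ^ n) 0 := by
    intro x
    have hx : IsFactorMap (Homeomorph.addRight θ) (Homeomorph.addRight θ) (x + ·) :=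
      ⟨continuous_const.add continuous_id, add_left_surjective x, fun g => (add_assoc x g θ).symm⟩
    simpa using (hx.map_zpow n 0).symm
  rw [hn x, hn y]
  exact h (a := (x, _)) (b := (y, _)) (by simpa [Prod.dist_eq, hδ] using hxy)

/-- Let `α` be a factor map from a minimal system `X` to a rotation of `G`. The quotient of `G` by
the closed subgroup generated by the differences `α x - α x'` with `π x = π x'` is a factor of `Z`;
moreover `Z` and `G` are relatively disjoint over it, and it is the largest quotient of `G` through
which the map factors. -/
theorem exists_rotation_pushout {X Z G : Type u} [MetricSpace X] [CompactSpace X] [MetricSpace Z]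
    [MetricSpace G] [CompactSpace G] [AddCommGroup G] [IsTopologicalAddGroup G]
    {T : X ≃ₜ X} {R : Z ≃ₜ Z} {θ : G} {π : X → Z} {α : X → G} (hT : IsMinimalSystem T)
    (hπ : IsFactorMap T R π) (hα : IsFactorMap T (Homeomorph.addRight θ) α) :
    ∃ (Q : Type u) (_ : MetricSpace Q) (_ : CompactSpace Q) (_ : AddCommGroup Q)
      (_ : IsTopologicalAddGroup Q) (q : G →+ Q) (κ : Z → Q),
      IsOpenMap q ∧ IsFactorMap (Homeomorph.addRight θ) (Homeomorph.addRight (q θ)) q ∧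
      IsFactorMap R (Homeomorph.addRight (q θ)) κ ∧ (∀ x, κ (π x) = q (α x)) ∧
      (∀ z g, κ z = q g → ∃ x, π x = z ∧ α x = g) ∧
      ∀ (W : Type u) [MetricSpace W] (P : W ≃ₜ W) (η : G → W),
        IsFactorMap (Homeomorph.addRight θ) P η →
        (∀ x x', π x = π x' → η (α x) = η (α x')) →
        ∃ η' : Q → W, IsFactorMap (Homeomorph.addRight (q θ)) P η' ∧ ∀ g, η' (q g) = η g := by
  have hG : IsMinimalSystem (Homeomorph.addRight θ) := hT.map hα
  have htrans : ∀ h : G, IsFactorMap (Homeomorph.addRight θ) (Homeomorph.addRight θ) (· + h) :=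
    fun h => ⟨continuous_id.add continuous_const, add_right_surjective h,
      fun g => add_right_comm g θ h⟩
  let D : Set G := {h | ∃ x x', π x = π x' ∧ h = α x - α x'}
  let H : AddSubgroup G := (AddSubgroup.closure D).topologicalClosure
  have hHc : IsClosed (H : Set G) := AddSubgroup.isClosed_topologicalClosure _
  have hDneg : ∀ h ∈ D, -h ∈ D := by
    rintro _ ⟨x, x', hx, rfl⟩
    exact ⟨x', x, hx.symm, neg_sub _ _⟩
  -- Since `D = -D`, closure under negation need not be assumed of `p`.
  have hind : ∀ p : G → Prop, p 0 → (∀ a b, p a → p b → p (a + b)) → (∀ a ∈ D, p a) →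
      IsClosed {a | p a} → ∀ h ∈ H, p h := by
    intro p h0 hadd hD hcl h hh
    refine closure_minimal (fun a ha => ?_) hcl hh
    have hpm : p a ∧ p (-a) := by
      refine AddSubgroup.closure_induction (p := fun a _ => p a ∧ p (-a))
        (fun a ha => ⟨hD a ha, hD _ (hDneg a ha)⟩) ⟨h0, by simpa using h0⟩
        (fun a b _ _ ha hb => ⟨hadd _ _ ha.1 hb.1, ?_⟩) (fun a _ ha => ⟨ha.2, by simpa using ha.1⟩)
        ha
      rw [neg_add]
      exact hadd _ _ ha.2 hb.2
    exact hpm.1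
  let f : X → Z × G := fun x => (π x, α x)
  have hf : Continuous f := hπ.continuous.prodMk hα.continuous
  have hM : IsClosed (range f) := (isCompact_range hf).isClosed
  -- The image of `X` in `Z × G` is stable under translation by `H`. For a generator `α x₁ - α x₂`,
  -- this is seen along the orbit of `x₂`, where `T ^ n x₁` is the required point.
  have hfib : ∀ h ∈ H, ∀ x, (π x, α x + h) ∈ range f := by
    refine hind _ (fun x => ⟨x, by simp [f]⟩) (fun a b ha hb x => ?_) ?_ ?_
    · obtain ⟨x₁, hx₁⟩ := ha x
      obtain ⟨x₂, hx₂⟩ := hb x₁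
      simp only [f, Prod.mk.injEq] at hx₁ hx₂
      exact ⟨x₂, Prod.ext (hx₂.1.trans hx₁.1) (by simp only [f]; rw [hx₂.2, hx₁.2, add_assoc])⟩
    · rintro _ ⟨x₁, x₂, h12, rfl⟩
      refine hT.forall_mem_of_isClosed (C := {x | (π x, α x + (α x₁ - α x₂)) ∈ range f})
        (hM.preimage (hπ.continuous.prodMk (hα.continuous.add continuous_const)))
        (x₀ := x₂) fun n => ?_
      refine ⟨(T ^ n) x₁, Prod.ext ?_ ?_⟩
      · simp only [f]; rw [hπ.map_zpow, hπ.map_zpow, h12]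
      · simp only [f]
        rw [hα.map_zpow, hα.map_zpow, (htrans _).map_zpow, add_sub_cancel]
    · simp only [ofPred_forall]
      exact isClosed_iInter fun x =>
        hM.preimage (continuous_const.prodMk (continuous_const.add continuous_id))
  have : T3Space (G ⧸ H) := inferInstance
  have : SecondCountableTopology (G ⧸ H) := inferInstance
  let mQ : MetricSpace (G ⧸ H) := TopologicalSpace.metrizableSpaceMetric (G ⧸ H)
  let q : G →+ G ⧸ H := QuotientAddGroup.mk' H
  have hqc : Continuous q := QuotientAddGroup.continuous_mk
  have hqo : IsOpenMap q := QuotientAddGroup.isOpenMap_coe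
  have hqs : Function.Surjective q := QuotientAddGroup.mk'_surjective H
  have hqq : IsQuotientMap q := hqo.isQuotientMap hqc hqs
  have hq : ∀ a b : G, q a = q b ↔ b - a ∈ H := fun a b => by
    rw [sub_eq_neg_add]; exact QuotientAddGroup.eq
  have hqf : IsFactorMap (Homeomorph.addRight θ) (Homeomorph.addRight (q θ)) q :=
    ⟨hqc, hqs, fun g => map_add q g θ⟩
  have hDH : ∀ x x', π x = π x' → q (α x) = q (α x') := fun x x' h =>
    (hq _ _).2 (AddSubgroup.le_topologicalClosure _
      (AddSubgroup.subset_closure ⟨x', x, h.symm, rfl⟩))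
  let κ : Z → G ⧸ H := fun z => q (α (Function.surjInv hπ.surjective z))
  have hκ : ∀ x, κ (π x) = q (α x) := fun x =>
    hDH _ _ (Function.surjInv_eq hπ.surjective (π x))
  have hκc : κ ∘ π = q ∘ α := funext hκ
  refine ⟨G ⧸ H, mQ, inferInstance, inferInstance, inferInstance, q, κ, hqo, hqf, ?_, hκ, ?_, ?_⟩
  · refine ⟨?_, ?_, fun z => ?_⟩
    · have hπq : IsQuotientMap π :=
        hπ.continuous.isClosedMap.isQuotientMap hπ.continuous hπ.surjective
      rw [hπq.continuous_iff, hκc]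
      exact hqc.comp hα.continuous
    · refine Function.Surjective.of_comp (g := π) ?_
      rw [hκc]
      exact hqs.comp hα.surjective
    · obtain ⟨x, rfl⟩ := hπ.surjective z
      rw [← hπ.semiconj, hκ, hκ, hα.semiconj, hqf.semiconj]
  · intro z g hzg
    obtain ⟨x, rfl⟩ := hπ.surjective z
    rw [hκ, hq] at hzg
    obtain ⟨x', hx'⟩ := hfib _ hzg x
    simp only [f, Prod.mk.injEq, add_sub_cancel] at hx'
    exact ⟨x', hx'⟩
  · intro W _ P η hη hηα
    have hinv : ∀ h ∈ H, ∀ g, η (g + h) = η g := by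
      refine hind _ (fun g => by rw [add_zero])
        (fun a b ha hb g => by rw [← add_assoc, hb, ha]) ?_ ?_
      · rintro _ ⟨x₁, x₂, h12, rfl⟩
        refine hG.forall_mem_of_isClosed (C := {g | η (g + (α x₁ - α x₂)) = η g})
          (isClosed_eq (hη.continuous.comp (continuous_id.add continuous_const)) hη.continuous)
          (x₀ := α x₂) fun n => ?_
        rw [mem_ofPred_eq, (htrans _).map_zpow, hη.map_zpow, hη.map_zpow, add_sub_cancel,
          hηα _ _ h12]
      · simp only [ofPred_forall]
        exact isClosed_iInter fun g =>
          isClosed_eq (hη.continuous.comp (continuous_const.add continuous_id)) continuous_const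
    let η' : G ⧸ H → W := fun w => η (Function.surjInv hqs w)
    have hη' : ∀ g, η' (q g) = η g := fun g => by
      have h := hinv _ ((hq _ _).1 (Function.surjInv_eq hqs (q g)).symm) g
      rw [add_sub_cancel] at h
      exact h
    have hη'c : η' ∘ q = η := funext hη'
    refine ⟨η', ⟨?_, ?_, fun w => ?_⟩, hη'⟩
    · rw [hqq.continuous_iff, hη'c]
      exact hη.continuous
    · refine Function.Surjective.of_comp (g := q) ?_
      rw [hη'c]
      exact hη.surjective
    · obtain ⟨g, rfl⟩ := hqs w
      rw [← hqf.semiconj, hη', hη', hη.semiconj]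

end Rotation

/-! ### The two parts of the theorem -/

theorem QuasiDisjoint.of_factor {X Y Z : Type u} [MetricSpace X] [CompactSpace X] [MetricSpace Y]
    [MetricSpace Z] {T : X ≃ₜ X} {S : Y ≃ₜ Y} {R : Z ≃ₜ Z} (hT : IsMinimalSystem T)
    {π : X → Z} (hπ : IsFactorMap T R π) (h : QuasiDisjoint T S) : QuasiDisjoint R S := by
  obtain ⟨E, _, _, A, πX, Yeq, _, _, SY, πY, hX, hY, hJ⟩ := h
  -- The empty system carries no group structure, so it is not a rotation.
  rcases isEmpty_or_nonempty X with hXe | hXn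
  · have hZe : IsEmpty Z := ⟨fun z => hXe.elim (hπ.surjective z).choose⟩
    refine ⟨Z, inferInstance, inferInstance, R, id, Yeq, inferInstance, inferInstance, SY, πY,
      ⟨⟨continuous_id, Function.surjective_id, fun _ => rfl⟩, ?_, ?_⟩, hY,
      fun J _ _ => Subsingleton.elim _ _⟩
    · exact Metric.uniformEquicontinuous_iff.2 fun ε hε => ⟨1, one_pos, fun z => hZe.elim z⟩
    · exact fun W _ _ Q φ _ hφ => ⟨φ, hφ, rfl⟩
  · have : Nonempty E := hXn.map πX
    obtain ⟨_, _, θ, rfl⟩ := hX.equicontinuous.exists_eq_addRight (hT.map hX.factor)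
    obtain ⟨G, _, _, _, _, q, κ, -, hq, hκ, hκπ, hfib, hdesc⟩ :=
      exists_rotation_pushout hT hπ hX.factor
    refine ⟨G, inferInstance, inferInstance, Homeomorph.addRight (q θ), κ, Yeq, inferInstance,
      inferInstance, SY, πY, ⟨hκ, isEquicontinuousSystem_addRight _, ?_⟩, hY, ?_⟩
    · intro W _ _ Q φ hQ hφ
      obtain ⟨η, hη, hηφ⟩ := hX.universal W Q (φ ∘ π) hQ (hφ.comp hπ)
      have hηφ' : ∀ x, φ (π x) = η (πX x) := congrFun hηφ
      obtain ⟨η', hη', hη'q⟩ := hdesc W Q η hη fun x x' hx => by rw [← hηφ', ← hηφ', hx]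
      refine ⟨η', hη', funext fun z => ?_⟩
      obtain ⟨x, rfl⟩ := hπ.surjective z
      rw [Function.comp_apply, hκπ, hη'q, hηφ']
    · intro J hJj hJeq
      have huniv := hJ _ (hJj.preimage hπ) (eq_univ_of_forall fun ⟨e, w⟩ => by
        obtain ⟨⟨z, y⟩, hzy, hew⟩ : (q e, w) ∈ Prod.map κ πY '' J := hJeq ▸ mem_univ _
        obtain ⟨h₁, h₂⟩ := Prod.ext_iff.1 hew
        obtain ⟨x, rfl, hx⟩ := hfib z e h₁
        exact ⟨(x, y), hzy, Prod.ext hx h₂⟩)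
      refine eq_univ_of_forall fun p => ?_
      obtain ⟨x, rfl⟩ := (hπ.prodMap_id S).surjective p
      exact eq_univ_iff_forall.1 huniv x

theorem StronglyQuasiDisjoint.of_factor {X Y Z : Type u} [MetricSpace X] [CompactSpace X]
    [MetricSpace Y] [CompactSpace Y] [MetricSpace Z] {T : X ≃ₜ X} {S : Y ≃ₜ Y} {R : Z ≃ₜ Z}
    (hT : IsMinimalSystem T) {π : X → Z} (hπ : IsFactorMap T R π)
    (h : StronglyQuasiDisjoint T S) : StronglyQuasiDisjoint R S := by
  obtain ⟨E, _, _, _, _, θ, α, β, hE, Ω, hΩ, hmin⟩ := h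
  obtain ⟨G, _, _, _, _, q, κ, hqo, hq, hκ, hκπ, hfib, hdesc⟩ :=
    exists_rotation_pushout hT hπ hE.factor_left
  refine ⟨G, inferInstance, inferInstance, inferInstance, inferInstance, q θ, κ, q ∘ β,
    ⟨hκ, hq.comp hE.factor_right, isEquicontinuousSystem_addRight _, ?_⟩, q '' Ω,
    image_mem_residual_of_isOpenMap hq.continuous hqo hq.surjective hΩ, ?_⟩
  · intro W _ _ Q φ ψ hQ hφ hψ
    obtain ⟨η₁, η₂, hη₁, hη₂, hφη, hψη⟩ := hE.universal W Q (φ ∘ π) ψ hQ (hφ.comp hπ) hψ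
    have hφη' : ∀ x, φ (π x) = η₁ (α x) := congrFun hφη
    -- Two factor maps from a minimal rotation to `W` differ by a translation of the source, so the
    -- descent of `η₁` also yields that of `η₂`.
    obtain ⟨g₀, hg₀⟩ := hη₁.surjective (η₂ 0)
    have htrans : ∀ g, η₂ g = η₁ (g₀ + g) := by
      have hg : IsFactorMap (Homeomorph.addRight θ) (Homeomorph.addRight θ) (g₀ + ·) :=
        ⟨continuous_const.add continuous_id, add_left_surjective g₀,
          fun g => (add_assoc g₀ g θ).symm⟩
      refine (hT.map hE.factor_left).forall_mem_of_isClosed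
        (C := {g | η₂ g = η₁ (g₀ + g)}) (isClosed_eq hη₂.continuous (hη₁.comp hg).continuous)
        (x₀ := 0) fun n => ?_
      rw [mem_ofPred_eq, hg.map_zpow, hη₂.map_zpow, hη₁.map_zpow, add_zero, hg₀]
    obtain ⟨η₁', hη₁', hη₁q⟩ := hdesc W Q η₁ hη₁ fun x x' hx => by rw [← hφη', ← hφη', hx]
    have hshift : IsFactorMap (Homeomorph.addRight (q θ)) (Homeomorph.addRight (q θ)) (q g₀ + ·) :=
      ⟨continuous_const.add continuous_id, add_left_surjective _,
        fun g => (add_assoc (q g₀) g (q θ)).symm⟩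
    refine ⟨η₁', η₁' ∘ (q g₀ + ·), hη₁', hη₁'.comp hshift, funext fun z => ?_, ?_⟩
    · obtain ⟨x, rfl⟩ := hπ.surjective z
      rw [Function.comp_apply, hκπ, hη₁q, hφη']
    · rw [hψη]
      funext y
      simp only [Function.comp_apply]
      rw [← map_add, hη₁q, htrans]
  · rintro _ ⟨c, hc, rfl⟩
    have himage := (hmin c hc).image (hπ.prodMap_id S)
    convert himage using 1
    ext ⟨z, y⟩
    simp only [mem_preimage, mem_singleton_iff, Function.comp_apply, mem_image]
    constructor
    · intro hzy
      -- The lift can be chosen with `α x = c + β y` exactly, not merely modulo `H`.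
      obtain ⟨x, rfl, hx⟩ := hfib z (c + β y) (by rw [map_add, ← hzy, sub_add_cancel])
      exact ⟨(x, y), by simp [hx], rfl⟩
    · rintro ⟨⟨x, y'⟩, hxy, h⟩
      obtain ⟨rfl, rfl⟩ := Prod.ext_iff.1 h
      change κ (π x) - q (β y') = q c
      rw [hκπ, ← map_sub]
      exact congrArg q hxy

theorem theorem1p2 {X Y Z : Type u}
    [MetricSpace X] [CompactSpace X] [MetricSpace Y] [CompactSpace Y]
    [MetricSpace Z] [CompactSpace Z]
    (T : X ≃ₜ X) (S : Y ≃ₜ Y) (R : Z ≃ₜ Z)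
    (hT : IsMinimalSystem T) (hS : IsMinimalSystem S)
    (π : X → Z) (hπ : IsFactorMap T R π) :
    (QuasiDisjoint T S → QuasiDisjoint R S) ∧
      (StronglyQuasiDisjoint T S → StronglyQuasiDisjoint R S) :=
  ⟨QuasiDisjoint.of_factor hT hπ, StronglyQuasiDisjoint.of_factor hT hπ⟩
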